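/- Let $\mathfrak A=(A,+,-,;,{}^{\smile},1')$ be a complete and atomic relation algebra. An element $f$ is a \emph{function} if $f^{\smile};f\le 1'$; an atom $x\le 1'$ is \emph{measurable} if $x;1;x$ is a sum of functions; and $\mathfrak A$ is \emph{measurable} if $1'$ is a sum of measurable atoms. Assume that $\mathfrak A$ is measurable, let $I$ be the set of its measurable atoms, and let $\mathcal E=\{(x,y)\in I\times I: x;1;y\neq 0\}$, which is an equivalence relation on $I$. A \emph{group triple} $(G,\varphi,C)$ over $\mathcal E$ consists of pairwise disjoint groups $G_x$ ($x\in I$); for each $(x,y)\in\mathcal E$, normal subgroups $H_{xy}$ of $G_x$ and $K_{xy}$ of $G_y$ and an isomorphism $\varphi_{xy}:G_x/H_{xy}\to G_y/K_{xy}$; and, for all $x,y,z$ with $(x,y),(y,z)\in\mathcal E$, a coset $C_{xyz}$ of the normal subgroup $H_{xy}\circ H_{xz}$ in $G_x$, where $\circ$ is the complex product. It is a \emph{coset semi-frame} if, for all $x\in I$, all $(x,y)\in\mathcal E$, and all $x,y,z$ with $(x,y),(y,z)\in\mathcal E$ respectively: (i) $\varphi_{xx}$ is the identity automorphism of $G_x/\{e_x\}$;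 (ii) $\varphi_{yx}=\varphi_{xy}^{-1}$ (in particular $H_{yx}=K_{xy}$ and $K_{yx}=H_{xy}$); (iii) $\varphi_{xy}[H_{xy}\circ H_{xz}]=K_{xy}\circ H_{yz}$; (iv) $\hat\varphi_{xy}\,|\,\hat\varphi_{yz}=\tau\,|\,\hat\varphi_{xz}$, where mappings are composed from left to right, $\hat\varphi_{xy},\hat\varphi_{yz},\hat\varphi_{xz}$ are the isomorphisms induced by $\varphi_{xy},\varphi_{yz},\varphi_{xz}$ on $G_x/(H_{xy}\circ H_{xz})$, $G_y/(K_{xy}\circ H_{yz})$, $G_x/(H_{xy}\circ H_{xz})$, and $\tau$ is the inner automorphism $D\mapsto C_{xyz}^{-1}\,D\,C_{xyz}$ of $G_x/(H_{xy}\circ H_{xz})$. A \emph{semi-scaffold} is a system $a=\langle a_{xy}:(x,y)\in\mathcal E\rangle$ of atoms of $\mathfrak A$ such that $a_{xy}\le x;1;y$, $a_{xx}=x$ and $a_{yx}=a_{xy}^{\smile}$ for all $(x,y)\in\mathcal E$ and all $x\in I$. \textbf{Theorem (Semi-frame Theorem).} Let $a$ be a semi-scaffold in $\mathfrak A$. Then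 there is exactly one group triple $(G,\varphi,C)$ over $\mathcal E$ such that - $G_x$ is the set of non-zero functions below $x;1;x$, with multiplication $;$, inverse ${}^{\smile}$ and identity $x$; - $H_{xy}=\{f\in G_x: f;a_{xy}=a_{xy}\}$ and $K_{xy}=\{g\in G_y: a_{xy};g=a_{xy}\}$; - $\varphi_{xy}$ maps the coset of $f\in G_x$ to the coset of $g\in G_y$ if and only if $f;a_{xy}=a_{xy};g$; - $C_{xyz}$ is the coset of $H_{xy}\circ H_{xz}$ that contains some $f\in G_x$ with $f;a_{xz}\le a_{xy};a_{yz}$; and this group triple is a coset semi-frame. -/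

import Mathlib

universe u v

/-- The non-Boolean part of a relation algebra: relative multiplication, converse and the
identity element on a Boolean algebra `A` (whose unit `1` is `⊤` and whose zero is `⊥`), subject to
the associative law, the identity law, the two involution laws, the two distributive laws and
Tarski's law. -/
class RelationAlgebra (A : Type u) [BooleanAlgebra A] where
  /-- relative multiplication `r ; s` -/
  comp : A → A → A
  /-- converse -/
  conv : A → A
  /-- the identity element `1'` -/
  ident : A
  comp_assoc : ∀ r s t, comp r (comp s t) = comp (comp r s) t
  comp_ident : ∀ r, comp r ident = r
  conv_conv : ∀ r, conv (conv r) = r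
  conv_comp : ∀ r s, conv (comp r s) = comp (conv s) (conv r)
  sup_comp : ∀ r s t, comp (r ⊔ s) t = comp r t ⊔ comp s t
  conv_sup : ∀ r s, conv (r ⊔ s) = conv r ⊔ conv s
  tarski : ∀ r s, comp (conv r) (comp r s)ᶜ ⊔ sᶜ = sᶜ

namespace RelationAlgebra

infixl:75 " ⨾ " => RelationAlgebra.comp

section Basic

variable {A : Type u} [BooleanAlgebra A] [RelationAlgebra A]

/-- Functional elements. -/
def IsFunction (f : A) : Prop := conv f ⨾ f ≤ ident

/-- A measurable atom: an atom `x ≤ 1'` whose square `x ; 1 ; x` is a sum of functions. -/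
structure IsMeasurableAtom (x : A) : Prop where
  isAtom : IsAtom x
  le_ident : x ≤ ident
  square : ∃ F : Set A, (∀ f ∈ F, IsFunction f) ∧ IsLUB F (x ⨾ ⊤ ⨾ x)

variable (A) in
/-- A relation algebra is measurable if its identity element is a sum of measurable atoms. -/
def IsMeasurable : Prop :=
  ∃ S : Set A, (∀ x ∈ S, IsMeasurableAtom x) ∧ IsLUB S (ident : A)

variable (A) in
/-- The index set `I` of all measurable atoms. -/
abbrev MeasurableAtoms : Type u := {x : A // IsMeasurableAtom x}

/-- The set of non-zero functions below the square `x ; 1 ; x`. -/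
def squareFunctions (x : A) : Set A := {f | f ≠ ⊥ ∧ IsFunction f ∧ f ≤ x ⨾ ⊤ ⨾ x}

/-! Helper facts, used only to see that `x ; 1 ; y ≠ 0` is an equivalence relation. -/

theorem conv_mono {r s : A} (h : r ≤ s) : conv r ≤ conv s := by
  rw [← sup_eq_right.mpr h, conv_sup]; exact le_sup_left

theorem comp_mono_left {r s : A} (h : r ≤ s) (t : A) : r ⨾ t ≤ s ⨾ t := by
  rw [← sup_eq_right.mpr h, sup_comp]; exact le_sup_left

theorem comp_mono_right {r s : A} (t : A) (h : r ≤ s) : t ⨾ r ≤ t ⨾ s := by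
  have := conv_mono (comp_mono_left (conv_mono h) (conv t))
  simpa only [conv_comp, conv_conv] using this

theorem conv_ident : conv (ident : A) = ident := by
  have h := conv_comp (conv (ident : A)) ident
  rw [comp_ident, conv_conv, comp_ident] at h
  exact h.symm

theorem ident_comp (r : A) : ident ⨾ r = r := by
  have h := conv_comp (conv r) (ident : A)
  rw [comp_ident, conv_conv, conv_ident] at h
  exact h.symm

theorem conv_top : conv (⊤ : A) = ⊤ := by
  have h := conv_mono (le_top : conv (⊤ : A) ≤ ⊤)
  rw [conv_conv] at h
  exact top_le_iff.mp h

theorem conv_ne_bot {r : A} (h : r ≠ ⊥) : conv r ≠ ⊥ := fun h0 => h <| by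
  have h1 := conv_mono (bot_le : (⊥ : A) ≤ conv ⊥)
  rw [conv_conv, le_bot_iff] at h1
  rw [← conv_conv r, h0, h1]

theorem cycle {r s t : A} (h : (r ⨾ s) ⊓ t = ⊥) : (conv r ⨾ t) ⊓ s = ⊥ := by
  have h1 : t ≤ (r ⨾ s)ᶜ := (disjoint_iff.mpr h).symm.le_compl_right
  have h2 : conv r ⨾ t ≤ sᶜ :=
    (comp_mono_right _ h1).trans (sup_eq_right.mp (tarski r s))
  exact disjoint_iff.mp (disjoint_compl_left.mono_left h2)

theorem le_comp_top (r : A) : r ≤ r ⨾ ⊤ :=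
  (comp_ident r).symm.le.trans (comp_mono_right r le_top)

theorem le_comp_conv_comp (r : A) : r ≤ r ⨾ conv r ⨾ r := by
  have h0 : (r ⨾ (conv r ⨾ r)) ⊓ (r ⊓ (r ⨾ (conv r ⨾ r))ᶜ) = ⊥ := by
    rw [inf_left_comm, inf_compl_eq_bot, inf_bot_eq]
  have h1 := cycle h0
  rw [inf_eq_left.mpr (comp_mono_right (conv r) inf_le_left)] at h1
  have h2 := cycle (t := ⊤) (h1 ▸ inf_top_eq _ : (conv r ⨾ (r ⊓ (r ⨾ (conv r ⨾ r))ᶜ)) ⊓ ⊤ = ⊥)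
  rw [conv_conv, inf_eq_right.mpr (inf_le_left.trans (le_comp_top r))] at h2
  rw [← comp_assoc]
  exact disjoint_compl_right_iff.mp (disjoint_iff.mpr h2)

theorem conv_eq_self {x : A} (h : x ≤ ident) : conv x = x := by
  have key : ∀ y : A, y ≤ ident → y ≤ conv y := fun y hy =>
    calc y ≤ y ⨾ conv y ⨾ y := le_comp_conv_comp y
      _ ≤ ident ⨾ conv y ⨾ y := comp_mono_left (comp_mono_left hy _) _
      _ ≤ ident ⨾ conv y ⨾ ident := comp_mono_right _ hy
      _ = conv y := by rw [comp_ident, ident_comp]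
  refine le_antisymm ?_ (key x h)
  have := key (conv x) ((conv_mono h).trans conv_ident.le)
  rwa [conv_conv] at this

theorem rect_self_ne_bot {x : A} (h : x ≠ ⊥) : x ⨾ ⊤ ⨾ x ≠ ⊥ := fun h0 => h <| by
  have : x ≤ x ⨾ ⊤ ⨾ x :=
    (le_comp_conv_comp x).trans (comp_mono_left (comp_mono_right _ le_top) _)
  rwa [h0, le_bot_iff] at this

theorem conv_rect {x y : A} (hx : x ≤ ident) (hy : y ≤ ident) :
    conv (x ⨾ ⊤ ⨾ y) = y ⨾ ⊤ ⨾ x := by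
  rw [conv_comp, conv_comp, conv_top, conv_eq_self hx, conv_eq_self hy, comp_assoc]

theorem le_of_rect_ne_bot {x y : A} (hy : IsAtom y) (h : x ⨾ ⊤ ⨾ y ≠ ⊥) : y ≤ ⊤ ⨾ x ⨾ ⊤ := by
  by_contra hn
  have h1 : (⊤ ⨾ (x ⨾ ⊤)) ⊓ y = ⊥ := by
    rw [comp_assoc]
    exact (inf_comm _ _).trans (hy.2 _ (inf_le_left.lt_of_ne fun he => hn (inf_eq_left.mp he)))
  have h2 := cycle h1
  rw [conv_top] at h2
  refine h (le_bot_iff.mp (h2 ▸ le_inf (comp_mono_left le_top y) ?_))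
  rw [← comp_assoc]
  exact comp_mono_right _ le_top

theorem rect_ne_bot_of_le {x z : A} (hx : x ≤ ident) (hz : z ≠ ⊥) (h : z ≤ ⊤ ⨾ x ⨾ ⊤) :
    x ⨾ ⊤ ⨾ z ≠ ⊥ := fun h0 => hz <| by
  have h1 : (x ⨾ (⊤ ⨾ z)) ⊓ ⊤ = ⊥ := by rw [comp_assoc, h0, bot_inf_eq]
  have h2 := cycle h1
  rw [conv_eq_self hx, inf_comm] at h2
  have h3 := cycle h2
  rwa [conv_top, comp_assoc, inf_eq_right.mpr h] at h3

end Basic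

/-- The equivalence relation `ℰ` on the set of measurable atoms: `x` and `y` are related if and
only if the rectangle `x ; 1 ; y` is not zero. -/
def rectSetoid (A : Type u) [BooleanAlgebra A] [RelationAlgebra A] :
    Setoid (MeasurableAtoms A) where
  r x y := (x : A) ⨾ ⊤ ⨾ (y : A) ≠ ⊥
  iseqv :=
    { refl := fun x => rect_self_ne_bot x.2.isAtom.1
      symm := fun {x y} h => by
        rw [← conv_rect x.2.le_ident y.2.le_ident]
        exact conv_ne_bot h
      trans := fun {x y z} hxy hyz => by
        have h1 := le_of_rect_ne_bot y.2.isAtom hxy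
        have h2 := le_of_rect_ne_bot z.2.isAtom hyz
        refine rect_ne_bot_of_le x.2.le_ident z.2.isAtom.1 (h2.trans ?_)
        refine (comp_mono_left (comp_mono_right ⊤ h1) ⊤).trans ?_
        rw [comp_assoc, comp_assoc, ← comp_assoc _ ⊤ ⊤]
        exact (comp_mono_right _ le_top).trans (comp_mono_left (comp_mono_left le_top _) _) }

/-- A semi-scaffold: a system of atoms `a x y`, indexed by the pairs `(x, y)` in `ℰ`. -/
structure SemiScaffold (A : Type u) [BooleanAlgebra A] [RelationAlgebra A] where
  elem : ∀ {x y : MeasurableAtoms A}, (rectSetoid A).r x y → A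
  isAtom : ∀ {x y : MeasurableAtoms A} (h : (rectSetoid A).r x y), IsAtom (elem h)
  le_rect : ∀ {x y : MeasurableAtoms A} (h : (rectSetoid A).r x y),
    elem h ≤ (x : A) ⨾ ⊤ ⨾ (y : A)
  elem_refl : ∀ x : MeasurableAtoms A, elem ((rectSetoid A).refl x) = (x : A)
  elem_symm : ∀ {x y : MeasurableAtoms A} (h : (rectSetoid A).r x y),
    elem ((rectSetoid A).symm h) = conv (elem h)

end RelationAlgebra

section QuotientIsomorphisms

variable {G : Type u} {G' : Type v} [Group G] [Group G'] {H : Subgroup G} {K : Subgroup G'}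
  [H.Normal] [K.Normal]

/-- The image `φ[N]` of a subgroup `N` under an isomorphism `φ : G ⧸ H ≃* G' ⧸ K`: the union of
the cosets `φ (f H)` with `f ∈ N`. -/
def quotientImage (φ : G ⧸ H ≃* G' ⧸ K) (N : Subgroup G) : Subgroup G' :=
  ((N.map (QuotientGroup.mk' H)).map φ.toMonoidHom).comap (QuotientGroup.mk' K)

theorem mem_quotientImage (φ : G ⧸ H ≃* G' ⧸ K) (N : Subgroup G) (g : G') :
    g ∈ quotientImage φ N ↔ ∃ f ∈ N, φ (f : G ⧸ H) = (g : G' ⧸ K) := by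
  simp [quotientImage]

instance quotientImage_normal (φ : G ⧸ H ≃* G' ⧸ K) (N : Subgroup G) [hN : N.Normal] :
    (quotientImage φ N).Normal :=
  ((hN.map _ (QuotientGroup.mk'_surjective H)).map _ φ.surjective).comap _

/-- `ψ : G ⧸ M ≃* G' ⧸ N` is the isomorphism induced by `φ : G ⧸ H ≃* G' ⧸ K` on coarser
quotients: it maps `f M` to `g N` whenever `φ` maps `f H` to `g K`. -/
def IsInducedBy {M : Subgroup G} {N : Subgroup G'} [M.Normal] [N.Normal]
    (φ : G ⧸ H ≃* G' ⧸ K) (ψ : G ⧸ M ≃* G' ⧸ N) : Prop :=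
  H ≤ M ∧ K ≤ N ∧
    ∀ (f : G) (g : G'), φ (f : G ⧸ H) = (g : G' ⧸ K) → ψ (f : G ⧸ M) = (g : G' ⧸ N)

end QuotientIsomorphisms

/-- A group triple `(G, φ, C)` over an equivalence relation `ℰ` on `I`: pairwise disjoint groups
with carriers inside `U`, isomorphisms `φ x y : G x ⧸ H x y ≃* G y ⧸ K x y` for `(x, y)` in `ℰ`,
and cosets `C x y z` of the normal subgroup `H x y ∘ H x z` of `G x` for `(x, y)` and `(y, z)` in
`ℰ`. The complex product of two normal subgroups is their join `⊔`. -/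
structure GroupTriple {I : Type u} (U : Type v) (E : Setoid I) where
  carrier : I → Set U
  group : ∀ x, Group (carrier x)
  disjoint : ∀ x y, x ≠ y → Disjoint (carrier x) (carrier y)
  H : ∀ {x y}, E.r x y → Subgroup (carrier x)
  K : ∀ {x y}, E.r x y → Subgroup (carrier y)
  H_normal : ∀ {x y} (h : E.r x y), (H h).Normal
  K_normal : ∀ {x y} (h : E.r x y), (K h).Normal
  φ : ∀ {x y} (h : E.r x y), carrier x ⧸ H h ≃* carrier y ⧸ K h
  C : ∀ {x y z} (hxy : E.r x y) (hyz : E.r y z), carrier x ⧸ (H hxy ⊔ H (E.trans hxy hyz))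

namespace GroupTriple

attribute [instance] GroupTriple.group GroupTriple.H_normal GroupTriple.K_normal

/-- The semi-frame conditions. In (i), `φ x x` is the identity on `G x ⧸ {e}`; in (ii),
`φ y x` is the inverse of `φ x y`; in (iv), mappings are composed from left to right and `τ` is
the inner automorphism `D ↦ c⁻¹ * D * c` determined by the coset `c = C x y z`. -/
structure IsSemiFrame {I : Type u} {U : Type v} {E : Setoid I} (F : GroupTriple U E) :
    Prop where
  cond_i : ∀ x : I, F.H (E.refl x) = ⊥ ∧ F.K (E.refl x) = ⊥ ∧
    ∀ f : F.carrier x, F.φ (E.refl x) (QuotientGroup.mk f) = QuotientGroup.mk f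
  cond_ii : ∀ {x y : I} (h : E.r x y), F.H (E.symm h) = F.K h ∧ F.K (E.symm h) = F.H h ∧
    ∀ (f : F.carrier x) (g : F.carrier y),
      F.φ h (QuotientGroup.mk f) = QuotientGroup.mk g ↔
        F.φ (E.symm h) (QuotientGroup.mk g) = QuotientGroup.mk f
  cond_iii : ∀ {x y z : I} (hxy : E.r x y) (hyz : E.r y z),
    quotientImage (F.φ hxy) (F.H hxy ⊔ F.H (E.trans hxy hyz)) = F.K hxy ⊔ F.H hyz
  cond_iv : ∀ {x y z : I} (hxy : E.r x y) (hyz : E.r y z),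
    ∃ (φxy : F.carrier x ⧸ (F.H hxy ⊔ F.H (E.trans hxy hyz)) ≃*
          F.carrier y ⧸ (F.K hxy ⊔ F.H hyz))
      (φyz : F.carrier y ⧸ (F.K hxy ⊔ F.H hyz) ≃*
          F.carrier z ⧸ quotientImage (F.φ (E.trans hxy hyz))
            (F.H hxy ⊔ F.H (E.trans hxy hyz)))
      (φxz : F.carrier x ⧸ (F.H hxy ⊔ F.H (E.trans hxy hyz)) ≃*
          F.carrier z ⧸ quotientImage (F.φ (E.trans hxy hyz))
            (F.H hxy ⊔ F.H (E.trans hxy hyz))),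
      IsInducedBy (F.φ hxy) φxy ∧ IsInducedBy (F.φ hyz) φyz ∧
      IsInducedBy (F.φ (E.trans hxy hyz)) φxz ∧
      φxy.trans φyz = (MulAut.conj (F.C hxy hyz)⁻¹ : MulAut _).trans φxz

open RelationAlgebra in
/-- `F` is the group triple determined by the semi-scaffold `a`: `G x` is the group, under `;` and
converse, of the non-zero functions below `x ; 1 ; x`, with identity `x`; `H x y` and `K x y` are
the left and right stabilizers of `a x y`; `φ x y` maps the coset of `f` to the coset of `g`
exactly when `f ; a x y = a x y ; g`; and `C x y z` is the coset modulo `H x y ∘ H x z` of an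
element `f` with `f ; a x z ≤ a x y ; a y z`. -/
structure IsDeterminedBy {A : Type u} [BooleanAlgebra A] [RelationAlgebra A]
    (F : GroupTriple A (rectSetoid A)) (a : SemiScaffold A) : Prop where
  carrier_eq : ∀ x, F.carrier x = squareFunctions (x : A)
  mul_eq : ∀ x, ∀ f g : F.carrier x, ((f * g : F.carrier x) : A) = (f : A) ⨾ (g : A)
  one_eq : ∀ x, ((1 : F.carrier x) : A) = (x : A)
  inv_eq : ∀ x, ∀ f : F.carrier x, ((f⁻¹ : F.carrier x) : A) = conv (f : A)
  mem_H : ∀ {x y : MeasurableAtoms A} (h : (rectSetoid A).r x y) (f : F.carrier x),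
    f ∈ F.H h ↔ (f : A) ⨾ a.elem h = a.elem h
  mem_K : ∀ {x y : MeasurableAtoms A} (h : (rectSetoid A).r x y) (g : F.carrier y),
    g ∈ F.K h ↔ a.elem h ⨾ (g : A) = a.elem h
  φ_eq : ∀ {x y : MeasurableAtoms A} (h : (rectSetoid A).r x y)
    (f : F.carrier x) (g : F.carrier y),
    F.φ h (QuotientGroup.mk f) = QuotientGroup.mk g ↔
      (f : A) ⨾ a.elem h = a.elem h ⨾ (g : A)
  C_eq : ∀ {x y z : MeasurableAtoms A} (hxy : (rectSetoid A).r x y)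
    (hyz : (rectSetoid A).r y z), ∃ f : F.carrier x,
    (f : A) ⨾ a.elem ((rectSetoid A).trans hxy hyz) ≤ a.elem hxy ⨾ a.elem hyz ∧
      F.C hxy hyz = QuotientGroup.mk f

end GroupTriple

/-! Measurability makes the non-zero functions below `x ⨾ ⊤ ⨾ x` into atoms that form a group with
identity `x`, and every non-zero element of the square lies above one of them. Fix an atom `b` below
`x ⨾ ⊤ ⨾ y`. Its left translates `f ⨾ b` and right translates `b ⨾ g` are again atoms, and each
family exhausts the rectangle (`exists_function_comp_le`, `exists_comp_function_le`), so left and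
right translates coincide. Since left and right translations commute, both stabilizers are normal,
and `f ⨾ b = b ⨾ g` is the graph of an isomorphism between the quotients by them (`stabEquiv`).

For a triangle of atoms `b`, `c`, `d` in the rectangles of `(x, y)`, `(y, z)`, `(x, z)`, the key is
that `b ⨾ conv b` is the sum of the left stabilizer of `b` (`exists_leftStab_comp_eq`). Hence two
functions that translate `d` below `b ⨾ c` differ by a product of elements stabilizing `b` and `d`
(`inv_mul_mem_sup`), so the coset `C` is well defined. Condition (iv) and one inclusion of (iii)
follow by comparing two such functions; the other inclusion of (iii) uses the key fact for `conv b`.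

Uniqueness holds because the description of the triple fixes each of its fields. -/

namespace RelationAlgebra

/-! ### Cycle laws and elements below rectangles. -/

section Calculus

variable {A : Type u} [BooleanAlgebra A] [RelationAlgebra A] {r s t p x y : A}

theorem conv_bot : conv (⊥ : A) = ⊥ := by
  by_contra h
  exact conv_ne_bot h (conv_conv ⊥)

theorem conv_le_iff : conv r ≤ s ↔ r ≤ conv s :=
  ⟨fun h => by simpa only [conv_conv] using conv_mono h,
    fun h => by simpa only [conv_conv] using conv_mono h⟩

theorem conv_inf (r s : A) : conv (r ⊓ s) = conv r ⊓ conv s := by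
  refine le_antisymm (le_inf (conv_mono inf_le_left) (conv_mono inf_le_right)) ?_
  rw [← conv_conv (conv r ⊓ conv s)]
  refine conv_mono (le_inf ?_ ?_)
  · exact conv_le_iff.mpr inf_le_left
  · exact conv_le_iff.mpr inf_le_right

theorem conv_injective : Function.Injective (conv : A → A) :=
  Function.LeftInverse.injective conv_conv

theorem comp_mono {r' s' : A} (h : r ≤ r') (h' : s ≤ s') : r ⨾ s ≤ r' ⨾ s' :=
  (comp_mono_left h s).trans (comp_mono_right r' h')

/-- The mirror image of `cycle`, obtained by passing to converses. -/
theorem cycle_right (h : (r ⨾ s) ⊓ t = ⊥) : (t ⨾ conv s) ⊓ r = ⊥ := by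
  have h1 : (conv s ⨾ conv r) ⊓ conv t = ⊥ := by rw [← conv_comp, ← conv_inf, h, conv_bot]
  have h2 := cycle h1
  rw [conv_conv] at h2
  have h3 := congrArg conv h2
  rwa [conv_inf, conv_comp, conv_conv, conv_conv, conv_bot] at h3

theorem comp_bot (r : A) : r ⨾ ⊥ = ⊥ := by
  have h : (conv r ⨾ ⊤) ⊓ ⊥ = ⊥ := inf_bot_eq _
  simpa only [conv_conv, inf_top_eq] using cycle h

theorem bot_comp (r : A) : ⊥ ⨾ r = ⊥ := by
  apply conv_injective
  rw [conv_comp, conv_bot, comp_bot]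

/-- Relative multiplication distributes over existing sums in its left argument. -/
theorem exists_comp_inf_ne_bot {F : Set A} {m : A} (hF : IsLUB F m) (hp : p ≠ ⊥)
    (h : p ≤ m ⨾ r) : ∃ f ∈ F, (f ⨾ r) ⊓ p ≠ ⊥ := by
  by_contra! hn
  have h1 : m ≤ (p ⨾ conv r)ᶜ := hF.2 fun f hf =>
    (disjoint_iff.mpr (cycle_right (hn f hf))).symm.le_compl_right
  have h2 : (p ⨾ conv r) ⊓ m = ⊥ := disjoint_iff.mp (disjoint_compl_right.mono_right h1)
  have h3 := cycle_right h2
  rw [conv_conv, inf_eq_right.mpr h] at h3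
  exact hp h3

theorem IsFunction.mono (hs : IsFunction s) (h : r ≤ s) : IsFunction r :=
  (comp_mono (conv_mono h) h).trans hs

theorem IsFunction.comp (hr : IsFunction r) (hs : IsFunction s) : IsFunction (r ⨾ s) := by
  unfold IsFunction
  rw [conv_comp, comp_assoc, ← comp_assoc (conv s)]
  refine (comp_mono_left (comp_mono_right _ hr) _).trans ?_
  rwa [comp_ident]

theorem comp_self_of_le_ident (hx : x ≤ ident) : x ⨾ x = x := by
  refine le_antisymm ((comp_mono_right x hx).trans (comp_ident x).le) ?_
  calc x ≤ x ⨾ conv x ⨾ x := le_comp_conv_comp x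
    _ ≤ x ⨾ x ⨾ ident := comp_mono (by rw [conv_eq_self hx]) hx
    _ = x ⨾ x := comp_ident _

theorem comp_eq_of_le_rect (hx : x ≤ ident) (h : p ≤ x ⨾ ⊤ ⨾ y) : x ⨾ p = p := by
  refine le_antisymm ((comp_mono_left hx p).trans (ident_comp p).le) ?_
  -- The part of `p` outside `x ⨾ p` is annihilated by `x`, hence disjoint from `x ⨾ ⊤ ⨾ y`, which
  -- contains it.
  have h0 : (x ⨾ p) ⊓ (p ⊓ (x ⨾ p)ᶜ) = ⊥ := by
    rw [inf_left_comm, inf_compl_eq_bot, inf_bot_eq]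
  have h1 := cycle h0
  rw [conv_eq_self hx, inf_eq_left.mpr] at h1
  · have h2 := cycle (t := ⊤ ⨾ y) (r := x) (s := p ⊓ (x ⨾ p)ᶜ) (by rw [h1, bot_inf_eq])
    rw [conv_eq_self hx, comp_assoc, inf_eq_right.mpr (inf_le_left.trans h)] at h2
    exact disjoint_compl_right_iff.mp (disjoint_iff.mpr h2)
  · exact (comp_mono_left hx _).trans ((ident_comp _).le.trans inf_le_left)

theorem conv_le_rect (hx : x ≤ ident) (hy : y ≤ ident) (h : p ≤ x ⨾ ⊤ ⨾ y) :
    conv p ≤ y ⨾ ⊤ ⨾ x := (conv_mono h).trans (conv_rect hx hy).le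

theorem comp_eq_of_le_rect' (hx : x ≤ ident) (hy : y ≤ ident) (h : p ≤ x ⨾ ⊤ ⨾ y) :
    p ⨾ y = p := by
  apply conv_injective
  rw [conv_comp, conv_eq_self hy]
  exact comp_eq_of_le_rect hy (conv_le_rect hx hy h)

theorem comp_le_rect {z q : A} (hp : p ≤ x ⨾ ⊤ ⨾ y) (hq : q ≤ y ⨾ ⊤ ⨾ z) :
    p ⨾ q ≤ x ⨾ ⊤ ⨾ z := by
  refine (comp_mono hp hq).trans ?_
  rw [comp_assoc, comp_assoc, ← comp_assoc x, ← comp_assoc x, ← comp_assoc x]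
  exact comp_mono_left (comp_mono_right _ le_top) _

/-- Otherwise the atom `x` is disjoint from `p ⨾ conv p`, and the cycle law makes `p = x ⨾ p`
disjoint from itself. -/
theorem le_comp_conv (hx : x ≤ ident) (hxa : IsAtom x) (hp : p ≠ ⊥) (h : p ≤ x ⨾ ⊤ ⨾ y) :
    x ≤ p ⨾ conv p := by
  by_contra hn
  have h1 : (p ⨾ conv p) ⊓ x = ⊥ := by
    rw [inf_comm]
    exact hxa.2 _ (inf_le_left.lt_of_ne fun he => hn (inf_eq_left.mp he))
  have h2 := cycle_right h1
  rw [conv_conv, comp_eq_of_le_rect hx h, inf_idem] at h2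
  exact hp h2

theorem le_conv_comp (hx : x ≤ ident) (hy : y ≤ ident) (hya : IsAtom y) (hp : p ≠ ⊥)
    (h : p ≤ x ⨾ ⊤ ⨾ y) : y ≤ conv p ⨾ p := by
  simpa only [conv_conv] using le_comp_conv hy hya (conv_ne_bot hp) (conv_le_rect hx hy h)

end Calculus

/-! ### The group of non-zero functions below a square. -/

section SquareFunctions

variable {A : Type u} [BooleanAlgebra A] [RelationAlgebra A] {x f g p : A}

theorem conv_comp_squareFunction (hx : IsMeasurableAtom x) (hf : f ∈ squareFunctions x) :
    conv f ⨾ f = x := by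
  refine le_antisymm ?_ (le_conv_comp hx.le_ident hx.le_ident hx.isAtom hf.1 hf.2.2)
  calc conv f ⨾ f = conv f ⨾ f ⨾ x := by
        rw [← comp_assoc, comp_eq_of_le_rect' hx.le_ident hx.le_ident hf.2.2]
    _ ≤ ident ⨾ x := comp_mono_left hf.2.1 x
    _ = x := ident_comp x

theorem isAtom_squareFunction (hx : IsMeasurableAtom x) (hf : f ∈ squareFunctions x) :
    IsAtom f := by
  -- A non-zero `p` below `f` has `x ≤ p ⨾ conv p`, and functionality of `f` then recovers `f` from
  -- `p`.
  refine ⟨hf.1, fun p hp => by_contra fun h0 => hp.not_ge ?_⟩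
  calc f = x ⨾ f := (comp_eq_of_le_rect hx.le_ident hf.2.2).symm
    _ ≤ p ⨾ conv p ⨾ f :=
        comp_mono_left (le_comp_conv hx.le_ident hx.isAtom h0 (hp.le.trans hf.2.2)) f
    _ ≤ p ⨾ (conv f ⨾ f) := by
        rw [← comp_assoc]
        exact comp_mono_right p (comp_mono_left (conv_mono hp.le) f)
    _ ≤ p ⨾ ident := comp_mono_right p hf.2.1
    _ = p := comp_ident p

theorem exists_squareFunction_le (hx : IsMeasurableAtom x) (hp : p ≠ ⊥) (h : p ≤ x ⨾ ⊤ ⨾ x) :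
    ∃ f ∈ squareFunctions x, f ≤ p := by
  obtain ⟨F, hF, hlub⟩ := hx.square
  obtain ⟨f, hf, hfp⟩ := exists_comp_inf_ne_bot (r := ident) hlub hp (by rwa [comp_ident])
  rw [comp_ident] at hfp
  exact ⟨f ⊓ p, ⟨hfp, (hF f hf).mono inf_le_left, inf_le_right.trans h⟩, inf_le_right⟩

/-- Measurability supplies a function `g` below `conv f`; as `f` is an atom, `conv g = f`, so `conv
f` is `g` itself. -/
theorem conv_mem_squareFunctions (hx : IsMeasurableAtom x) (hf : f ∈ squareFunctions x) :
    conv f ∈ squareFunctions x := by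
  have h := conv_le_rect hx.le_ident hx.le_ident hf.2.2
  obtain ⟨g, hg, hgf⟩ := exists_squareFunction_le hx (conv_ne_bot hf.1) h
  have h1 : conv g = f := ((isAtom_squareFunction hx hf).le_iff_eq (conv_ne_bot hg.1)).mp
    (conv_le_iff.mpr hgf)
  rwa [← h1, conv_conv]

theorem comp_mem_squareFunctions (hx : IsMeasurableAtom x) (hf : f ∈ squareFunctions x)
    (hg : g ∈ squareFunctions x) : f ⨾ g ∈ squareFunctions x := by
  refine ⟨fun h => hg.1 ?_, hf.2.1.comp hg.2.1, comp_le_rect hf.2.2 hg.2.2⟩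
  rw [← comp_eq_of_le_rect hx.le_ident hg.2.2, ← conv_comp_squareFunction hx hf, ← comp_assoc, h,
    comp_bot]

theorem self_mem_squareFunctions (hx : IsMeasurableAtom x) : x ∈ squareFunctions x := by
  refine ⟨hx.isAtom.1, ?_, ?_⟩
  · unfold IsFunction
    rw [conv_eq_self hx.le_ident, comp_self_of_le_ident hx.le_ident]
    exact hx.le_ident
  · exact (comp_self_of_le_ident hx.le_ident).symm.le.trans (comp_mono_left (le_comp_top x) x)

instance squareGroup (x : MeasurableAtoms A) : Group (squareFunctions (x : A)) where
  mul f g := ⟨(f : A) ⨾ (g : A), comp_mem_squareFunctions x.2 f.2 g.2⟩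
  one := ⟨x, self_mem_squareFunctions x.2⟩
  inv f := ⟨conv (f : A), conv_mem_squareFunctions x.2 f.2⟩
  mul_assoc f g h := Subtype.ext (comp_assoc _ _ _).symm
  one_mul f := Subtype.ext (comp_eq_of_le_rect x.2.le_ident f.2.2.2)
  mul_one f := Subtype.ext (comp_eq_of_le_rect' x.2.le_ident x.2.le_ident f.2.2.2)
  inv_mul_cancel f := Subtype.ext (conv_comp_squareFunction x.2 f.2)

theorem coe_inv_squareFunctions {x : MeasurableAtoms A} (f : squareFunctions (x : A)) :
    ((f⁻¹ : squareFunctions (x : A)) : A) = conv (f : A) := rfl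

/-- Distinct atoms below `ident` have product `⊥`, while a common element `f` would equal `x ⨾ y ⨾
f`. -/
theorem disjoint_squareFunctions {x y : MeasurableAtoms A} (h : x ≠ y) :
    Disjoint (squareFunctions (x : A)) (squareFunctions (y : A)) := by
  refine Set.disjoint_left.mpr fun f hx hy => hx.1 ?_
  have h0 : (x : A) ⨾ (y : A) = ⊥ := by
    by_contra h0
    refine h (Subtype.ext (((x.2.isAtom.le_iff_eq h0).mp ?_).symm.trans
      ((y.2.isAtom.le_iff_eq h0).mp ?_)))
    · exact (comp_mono_right _ y.2.le_ident).trans (comp_ident _).le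
    · exact (comp_mono_left x.2.le_ident _).trans (ident_comp _).le
  rw [← comp_eq_of_le_rect x.2.le_ident hx.2.2, ← comp_eq_of_le_rect y.2.le_ident hy.2.2,
    comp_assoc, h0, bot_comp]

end SquareFunctions

end RelationAlgebra

/-! ### Translates and stabilizers of an atom below a rectangle. -/

namespace RelationAlgebra

variable {A : Type u} [BooleanAlgebra A] [RelationAlgebra A]

/-- `b` is an atom below the rectangle `x ; 1 ; y`. -/
structure IsRectAtom (x y : MeasurableAtoms A) (b : A) : Prop where
  isAtom : IsAtom b
  le_rect : b ≤ (x : A) ⨾ ⊤ ⨾ (y : A)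

variable {x y z : MeasurableAtoms A} {b c d p : A}

theorem conv_isAtom (hb : IsAtom b) : IsAtom (conv b) := by
  refine ⟨conv_ne_bot hb.1, fun p hp => ?_⟩
  have h1 : conv p < b := lt_of_le_of_ne (conv_le_iff.mpr hp.le) fun h =>
    hp.ne (by rw [← h, conv_conv])
  rw [← conv_conv p, hb.2 _ h1, conv_bot]

theorem IsRectAtom.converse (hb : IsRectAtom x y b) : IsRectAtom y x (conv b) :=
  ⟨conv_isAtom hb.isAtom, conv_le_rect x.2.le_ident y.2.le_ident hb.le_rect⟩

theorem one_comp_eq (h : p ≤ (x : A) ⨾ ⊤ ⨾ (y : A)) :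
    ((1 : squareFunctions (x : A)) : A) ⨾ p = p := comp_eq_of_le_rect x.2.le_ident h

theorem comp_one_eq (h : p ≤ (x : A) ⨾ ⊤ ⨾ (y : A)) :
    p ⨾ ((1 : squareFunctions (y : A)) : A) = p :=
  comp_eq_of_le_rect' x.2.le_ident y.2.le_ident h

theorem mul_comp_eq (f f' : squareFunctions (x : A)) (p : A) :
    ((f * f' : squareFunctions (x : A)) : A) ⨾ p = (f : A) ⨾ ((f' : A) ⨾ p) :=
  (comp_assoc _ _ _).symm

theorem comp_mul_eq (g g' : squareFunctions (y : A)) (p : A) :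
    p ⨾ ((g * g' : squareFunctions (y : A)) : A) = (p ⨾ (g : A)) ⨾ (g' : A) :=
  comp_assoc _ _ _

theorem inv_comp_comp (h : p ≤ (x : A) ⨾ ⊤ ⨾ (y : A)) (f : squareFunctions (x : A)) :
    ((f⁻¹ : squareFunctions (x : A)) : A) ⨾ ((f : A) ⨾ p) = p := by
  rw [← mul_comp_eq, inv_mul_cancel, one_comp_eq h]

theorem comp_comp_inv (h : p ≤ (x : A) ⨾ ⊤ ⨾ (y : A)) (g : squareFunctions (y : A)) :
    (p ⨾ (g : A)) ⨾ ((g⁻¹ : squareFunctions (y : A)) : A) = p := by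
  rw [← comp_mul_eq, mul_inv_cancel, comp_one_eq h]

namespace IsRectAtom

/-- Translation by `f` is monotone and is undone by translation by `f⁻¹`, so it preserves atoms. -/
theorem function_comp (hb : IsRectAtom x y b) (f : squareFunctions (x : A)) :
    IsRectAtom x y ((f : A) ⨾ b) := by
  have hle := comp_le_rect f.2.2.2 hb.le_rect
  refine ⟨⟨fun h => hb.isAtom.1 ?_, fun p hp => ?_⟩, hle⟩
  · rw [← inv_comp_comp hb.le_rect f, h, comp_bot]
  · have hp' := hp.le.trans hle
    have h1 : ((f⁻¹ : squareFunctions (x : A)) : A) ⨾ p ≤ b := by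
      have h := comp_mono_right ((f⁻¹ : squareFunctions (x : A)) : A) hp.le
      rwa [inv_comp_comp hb.le_rect] at h
    have h2 := inv_comp_comp hp' f⁻¹
    rw [inv_inv] at h2
    rcases hb.isAtom.le_iff.mp h1 with h | h
    · rw [← h2, h, comp_bot]
    · rw [h] at h2
      exact absurd h2.symm hp.ne

theorem comp_function (hb : IsRectAtom x y b) (g : squareFunctions (y : A)) :
    IsRectAtom x y (b ⨾ (g : A)) := by
  have h := (hb.converse.function_comp g⁻¹).converse
  rwa [coe_inv_squareFunctions, conv_comp, conv_conv, conv_conv] at h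

/-- The rectangle `x ; 1 ; y` is the sum of the left translates of any atom below it. -/
theorem exists_function_comp_le (hb : IsRectAtom x y b) (hp : p ≠ ⊥)
    (h : p ≤ (x : A) ⨾ ⊤ ⨾ (y : A)) : ∃ f : squareFunctions (x : A), (f : A) ⨾ b ≤ p := by
  obtain ⟨F, hF, hlub⟩ := x.2.square
  -- Since `y ≤ conv b ⨾ b`, the rectangle is absorbed into the square of `x` times `b`, and that
  -- square is a sum of functions.
  have h1 : p ≤ (x : A) ⨾ ⊤ ⨾ (x : A) ⨾ b := by
    refine h.trans ?_
    calc (x : A) ⨾ ⊤ ⨾ (y : A) ≤ (x : A) ⨾ ⊤ ⨾ (conv b ⨾ b) := comp_mono_right _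
          (le_conv_comp x.2.le_ident y.2.le_ident y.2.isAtom hb.isAtom.1 hb.le_rect)
      _ = (x : A) ⨾ ⊤ ⨾ (conv b ⨾ (x : A) ⨾ b) := by
          rw [comp_eq_of_le_rect' y.2.le_ident x.2.le_ident hb.converse.le_rect]
      _ = (x : A) ⨾ (⊤ ⨾ conv b) ⨾ (x : A) ⨾ b := by simp only [comp_assoc]
      _ ≤ (x : A) ⨾ ⊤ ⨾ (x : A) ⨾ b :=
          comp_mono_left (comp_mono_left (comp_mono_right _ le_top) _) _
  obtain ⟨f, hf, hfp⟩ := exists_comp_inf_ne_bot hlub hp h1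
  have hf0 : f ≠ ⊥ := fun h0 => hfp (by rw [h0, bot_comp, bot_inf_eq])
  let f' : squareFunctions (x : A) := ⟨f, hf0, hF f hf, hlub.1 hf⟩
  exact ⟨f', inf_eq_left.mp ((((hb.function_comp f').isAtom).le_iff_eq hfp).mp inf_le_left)⟩

theorem exists_comp_function_le (hb : IsRectAtom x y b) (hp : p ≠ ⊥)
    (h : p ≤ (x : A) ⨾ ⊤ ⨾ (y : A)) : ∃ g : squareFunctions (y : A), b ⨾ (g : A) ≤ p := by
  obtain ⟨g, hg⟩ := hb.converse.exists_function_comp_le (conv_ne_bot hp)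
    (conv_le_rect x.2.le_ident y.2.le_ident h)
  refine ⟨g⁻¹, ?_⟩
  have := conv_mono hg
  rwa [conv_comp, conv_conv, conv_conv] at this

theorem eq_of_le (hb : IsRectAtom x y b) (hc : IsRectAtom x y c) (h : b ≤ c) : b = c :=
  (hc.isAtom.le_iff_eq hb.isAtom.1).mp h

theorem exists_comp_eq_right (hb : IsRectAtom x y b) (f : squareFunctions (x : A)) :
    ∃ g : squareFunctions (y : A), (f : A) ⨾ b = b ⨾ (g : A) := by
  have hfb := hb.function_comp f
  obtain ⟨g, hg⟩ := hb.exists_comp_function_le hfb.isAtom.1 hfb.le_rect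
  exact ⟨g, ((hb.comp_function g).eq_of_le hfb hg).symm⟩

theorem exists_comp_eq_left (hb : IsRectAtom x y b) (g : squareFunctions (y : A)) :
    ∃ f : squareFunctions (x : A), (f : A) ⨾ b = b ⨾ (g : A) := by
  have hbg := hb.comp_function g
  obtain ⟨f, hf⟩ := hb.exists_function_comp_le hbg.isAtom.1 hbg.le_rect
  exact ⟨f, (hb.function_comp f).eq_of_le hbg hf⟩

/-- The left stabilizer of an atom below `x ; 1 ; y`. -/
def leftStab (hb : IsRectAtom x y b) : Subgroup (squareFunctions (x : A)) where
  carrier := {f | (f : A) ⨾ b = b}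
  mul_mem' {f f'} hf hf' := by
    rw [Set.mem_ofPred_eq] at hf hf' ⊢
    rw [mul_comp_eq, hf', hf]
  one_mem' := one_comp_eq hb.le_rect
  inv_mem' {f} hf := by
    rw [Set.mem_ofPred_eq] at hf ⊢
    conv_lhs => rw [← hf]
    exact inv_comp_comp hb.le_rect f

/-- The right stabilizer of an atom below `x ; 1 ; y`. -/
def rightStab (hb : IsRectAtom x y b) : Subgroup (squareFunctions (y : A)) where
  carrier := {g | b ⨾ (g : A) = b}
  mul_mem' {g g'} hg hg' := by
    rw [Set.mem_ofPred_eq] at hg hg' ⊢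
    rw [comp_mul_eq, hg, hg']
  one_mem' := comp_one_eq hb.le_rect
  inv_mem' {g} hg := by
    rw [Set.mem_ofPred_eq] at hg ⊢
    conv_lhs => rw [← hg]
    exact comp_comp_inv hb.le_rect g

theorem mem_leftStab (hb : IsRectAtom x y b) {f : squareFunctions (x : A)} :
    f ∈ hb.leftStab ↔ (f : A) ⨾ b = b := Iff.rfl

theorem mem_rightStab (hb : IsRectAtom x y b) {g : squareFunctions (y : A)} :
    g ∈ hb.rightStab ↔ b ⨾ (g : A) = b := Iff.rfl

theorem inv_mul_mem_leftStab (hb : IsRectAtom x y b) {f f' : squareFunctions (x : A)} :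
    f⁻¹ * f' ∈ hb.leftStab ↔ (f : A) ⨾ b = (f' : A) ⨾ b := by
  rw [mem_leftStab, mul_comp_eq]
  constructor
  · intro h
    have h1 := inv_comp_comp (hb.function_comp f').le_rect f⁻¹
    rwa [inv_inv, h] at h1
  · intro h
    rw [← h, inv_comp_comp hb.le_rect]

theorem mul_inv_mem_rightStab (hb : IsRectAtom x y b) {g g' : squareFunctions (y : A)} :
    g * g'⁻¹ ∈ hb.rightStab ↔ b ⨾ (g : A) = b ⨾ (g' : A) := by
  rw [mem_rightStab, comp_mul_eq]
  constructor
  · intro h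
    have h1 := comp_comp_inv (hb.comp_function g).le_rect g'⁻¹
    rwa [inv_inv, h, eq_comm] at h1
  · intro h
    rw [h, comp_comp_inv hb.le_rect]

/-- A left translate of `b` is a right translate `b ⨾ g`, and an element that fixes `b` on the left
also fixes `b ⨾ g`. -/
instance leftStab_normal (hb : IsRectAtom x y b) : hb.leftStab.Normal where
  conj_mem f hf k := by
    rw [mem_leftStab] at hf
    obtain ⟨g, hg⟩ := hb.exists_comp_eq_right k⁻¹
    rw [← inv_inv k, inv_inv k⁻¹, mul_assoc, inv_mul_mem_leftStab, mul_comp_eq, hg, comp_assoc, hf]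

instance rightStab_normal (hb : IsRectAtom x y b) : hb.rightStab.Normal where
  conj_mem g hg k := by
    rw [mem_rightStab] at hg
    obtain ⟨f, hf⟩ := hb.exists_comp_eq_left k
    rw [mul_inv_mem_rightStab, comp_mul_eq, ← hf, ← comp_assoc, hg]

theorem mk_rightStab_eq (hb : IsRectAtom x y b) {g g' : squareFunctions (y : A)} :
    (QuotientGroup.mk g : _ ⧸ hb.rightStab) = QuotientGroup.mk g' ↔
      b ⨾ (g : A) = b ⨾ (g' : A) := by
  rw [QuotientGroup.eq, hb.rightStab_normal.mem_comm_iff, mul_inv_mem_rightStab, eq_comm]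

end IsRectAtom

end RelationAlgebra

/-! ### Induced isomorphisms of coarser quotients. -/

section QuotientIsomorphisms

variable {G : Type u} {G' : Type v} [Group G] [Group G'] {H : Subgroup G} {K : Subgroup G'}
  [H.Normal] [K.Normal]

/-- An isomorphism between quotients induces an isomorphism between coarser quotients. -/
theorem exists_isInducedBy (φ : G ⧸ H ≃* G' ⧸ K) {M : Subgroup G} {N : Subgroup G'} [M.Normal]
    [N.Normal] (hM : H ≤ M) (hN : quotientImage φ M = N) :
    ∃ ψ : G ⧸ M ≃* G' ⧸ N, IsInducedBy φ ψ := by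
  subst hN
  have hK : K ≤ quotientImage φ M := fun g hg => (mem_quotientImage φ M g).mpr
    ⟨1, M.one_mem, by rw [QuotientGroup.mk_one, map_one, (QuotientGroup.eq_one_iff g).mpr hg]⟩
  let q : G' ⧸ K →* G' ⧸ quotientImage φ M := QuotientGroup.map _ _ (MonoidHom.id G') hK
  let θ : G →* G' ⧸ quotientImage φ M := q.comp (φ.toMonoidHom.comp (QuotientGroup.mk' H))
  have hθ : ∀ (f : G) (g : G'), φ (f : G ⧸ H) = (g : G' ⧸ K) →
      θ f = (g : G' ⧸ quotientImage φ M) := fun f g h => congrArg q h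
  have hsurj : Function.Surjective θ := by
    intro d
    obtain ⟨g, rfl⟩ := QuotientGroup.mk_surjective d
    obtain ⟨f, hf⟩ := QuotientGroup.mk_surjective (φ.symm (g : G' ⧸ K))
    exact ⟨f, hθ f g (by rw [hf, MulEquiv.apply_symm_apply])⟩
  -- The hypothesis `H ≤ M` enters here: a representative congruent modulo `H` to an element of `M`
  -- is itself in `M`.
  have hker : M = θ.ker := by
    ext f
    obtain ⟨g, hg⟩ := QuotientGroup.mk_surjective (φ (f : G ⧸ H))
    rw [MonoidHom.mem_ker, hθ f g hg.symm, QuotientGroup.eq_one_iff, mem_quotientImage]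
    refine ⟨fun h => ⟨f, h, hg.symm⟩, ?_⟩
    rintro ⟨f', hf', h⟩
    have h1 : (f' : G ⧸ H) = f := φ.injective (h.trans hg)
    have h2 := M.mul_mem hf' (hM (QuotientGroup.eq.mp h1))
    rwa [mul_inv_cancel_left] at h2
  exact ⟨(QuotientGroup.quotientMulEquivOfEq hker).trans
    (QuotientGroup.quotientKerEquivOfSurjective θ hsurj), hM, hK, hθ⟩

end QuotientIsomorphisms

/-! ### Transfer along an atom, and triangles of atoms. -/

namespace RelationAlgebra

variable {A : Type u} [BooleanAlgebra A] [RelationAlgebra A] {x y z : MeasurableAtoms A}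
  {b c d p : A}

namespace IsRectAtom

/-- The element `g` with `f ; b = b ; g`, as a homomorphism onto the cosets of the right
stabilizer. -/
noncomputable def transferHom (hb : IsRectAtom x y b) :
    squareFunctions (x : A) →* squareFunctions (y : A) ⧸ hb.rightStab :=
  MonoidHom.mk' (fun f => QuotientGroup.mk (hb.exists_comp_eq_right f).choose) fun f f' => by
    rw [← QuotientGroup.mk_mul, mk_rightStab_eq, ← (hb.exists_comp_eq_right (f * f')).choose_spec,
      comp_mul_eq, ← (hb.exists_comp_eq_right f).choose_spec, ← comp_assoc,
      ← (hb.exists_comp_eq_right f').choose_spec, mul_comp_eq]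

theorem transferHom_eq (hb : IsRectAtom x y b) (f : squareFunctions (x : A))
    (g : squareFunctions (y : A)) :
    hb.transferHom f = QuotientGroup.mk g ↔ (f : A) ⨾ b = b ⨾ (g : A) := by
  rw [(hb.exists_comp_eq_right f).choose_spec]
  exact hb.mk_rightStab_eq

theorem transferHom_surjective (hb : IsRectAtom x y b) :
    Function.Surjective hb.transferHom := by
  intro d
  obtain ⟨g, rfl⟩ := QuotientGroup.mk_surjective d
  obtain ⟨f, hf⟩ := hb.exists_comp_eq_left g
  exact ⟨f, (hb.transferHom_eq f g).mpr hf⟩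

theorem leftStab_eq_ker (hb : IsRectAtom x y b) : hb.leftStab = hb.transferHom.ker := by
  ext f
  rw [MonoidHom.mem_ker, ← QuotientGroup.mk_one, transferHom_eq, comp_one_eq hb.le_rect,
    mem_leftStab]

/-- The isomorphism between the quotients by the left and right stabilizers of `b`. -/
noncomputable def stabEquiv (hb : IsRectAtom x y b) :
    squareFunctions (x : A) ⧸ hb.leftStab ≃* squareFunctions (y : A) ⧸ hb.rightStab :=
  (QuotientGroup.quotientMulEquivOfEq hb.leftStab_eq_ker).trans
    (QuotientGroup.quotientKerEquivOfSurjective _ hb.transferHom_surjective)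

theorem stabEquiv_mk (hb : IsRectAtom x y b) (f : squareFunctions (x : A))
    (g : squareFunctions (y : A)) :
    hb.stabEquiv (QuotientGroup.mk f) = QuotientGroup.mk g ↔ (f : A) ⨾ b = b ⨾ (g : A) :=
  hb.transferHom_eq f g

/-- By the cycle law `f ⨾ q` meets `p`, and both are atoms. -/
theorem function_comp_eq_of_le {q : A} (hp : IsRectAtom x z p) (hq : IsRectAtom x z q)
    (f : squareFunctions (x : A)) (h : (f : A) ≤ p ⨾ conv q) : (f : A) ⨾ q = p := by
  have h1 : ((f : A) ⨾ q) ⊓ p ≠ ⊥ := fun h0 => f.2.1 <| by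
    rw [← cycle_right h0, inf_eq_right.mpr h]
  have h2 := ((hq.function_comp f).isAtom.le_iff_eq h1).mp inf_le_left
  exact (hq.function_comp f).eq_of_le hp (inf_eq_left.mp h2)

/-- `b ; b˘` is the sum of the left stabilizer of `b`. -/
theorem exists_leftStab_comp_eq {q : A} (hb : IsRectAtom x y b) (hp : IsRectAtom x z p)
    (hq : IsRectAtom x z q) (h : p ≤ b ⨾ conv b ⨾ q) : ∃ f ∈ hb.leftStab, (f : A) ⨾ q = p := by
  -- One function below both products serves twice: below `b ⨾ conv b` it fixes `b`, and below `p ⨾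
  -- conv q` it carries `q` to `p`.
  have h1 : (p ⨾ conv q) ⊓ (b ⨾ conv b) ≠ ⊥ := fun h0 => hp.isAtom.1 <| by
    have h2 := cycle_right h0
    rwa [conv_conv, inf_eq_right.mpr h] at h2
  obtain ⟨f, hf, hfle⟩ := exists_squareFunction_le x.2 h1
    (inf_le_right.trans (comp_le_rect hb.le_rect hb.converse.le_rect))
  let f' : squareFunctions (x : A) := ⟨f, hf⟩
  exact ⟨f', hb.function_comp_eq_of_le hb f' (hfle.trans inf_le_right),
    hp.function_comp_eq_of_le hq f' (hfle.trans inf_le_left)⟩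

/-- This gives a representative of the coset `C`. The product `b ⨾ c` is non-zero because `c ≤ conv
b ⨾ b ⨾ c`. -/
theorem exists_function_comp_le_comp (hb : IsRectAtom x y b) (hc : IsRectAtom y z c)
    (hd : IsRectAtom x z d) : ∃ k : squareFunctions (x : A), (k : A) ⨾ d ≤ b ⨾ c := by
  refine hd.exists_function_comp_le (fun h => hc.isAtom.1 (le_bot_iff.mp ?_))
    (comp_le_rect hb.le_rect hc.le_rect)
  calc c = (y : A) ⨾ c := (comp_eq_of_le_rect y.2.le_ident hc.le_rect).symm
    _ ≤ conv b ⨾ b ⨾ c := comp_mono_left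
        (le_conv_comp x.2.le_ident y.2.le_ident y.2.isAtom hb.isAtom.1 hb.le_rect) c
    _ = ⊥ := by rw [← comp_assoc, h, comp_bot]

/-- `c ≤ b˘ ; p` whenever the atom `p` is below `b ; c`. -/
theorem le_conv_comp_of_le_comp (hc : IsRectAtom y z c) (hp : p ≠ ⊥) (h : p ≤ b ⨾ c) :
    c ≤ conv b ⨾ p := by
  have h1 : (conv b ⨾ p) ⊓ c ≠ ⊥ := fun h0 => hp <| by
    have h2 := cycle h0
    rwa [conv_conv, inf_eq_right.mpr h] at h2
  rw [inf_comm] at h1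
  exact inf_eq_left.mp ((hc.isAtom.le_iff_eq h1).mp inf_le_left)

/-- Two elements `f` with `f ; d ≤ b ; c` differ by an element of the product of the left
stabilizers of `b` and `d`. -/
theorem inv_mul_mem_sup (hb : IsRectAtom x y b) (hc : IsRectAtom y z c) (hd : IsRectAtom x z d)
    {f f' : squareFunctions (x : A)} (hf : (f : A) ⨾ d ≤ b ⨾ c) (hf' : (f' : A) ⨾ d ≤ b ⨾ c) :
    f⁻¹ * f' ∈ hb.leftStab ⊔ hd.leftStab := by
  have h1 : (f' : A) ⨾ d ≤ b ⨾ conv b ⨾ ((f : A) ⨾ d) := by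
    rw [← comp_assoc]
    exact hf'.trans (comp_mono_right b
      (hc.le_conv_comp_of_le_comp (hd.function_comp f).isAtom.1 hf))
  obtain ⟨h, hh, he⟩ := hb.exists_leftStab_comp_eq (hd.function_comp f') (hd.function_comp f) h1
  rw [← mul_comp_eq, ← inv_mul_mem_leftStab] at he
  -- Factor `f⁻¹ * f'` as `(f⁻¹ * h * f) * ((h * f)⁻¹ * f')`: the first factor stabilizes `b`, the
  -- second `d`.
  have h2 := mul_mem (Subgroup.mem_sup_left (hb.leftStab_normal.conj_mem h hh f⁻¹))
    (Subgroup.mem_sup_right (S := hb.leftStab) he)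
  convert h2 using 1
  group

theorem leftStab_converse (hb : IsRectAtom x y b) :
    hb.converse.leftStab = hb.rightStab := by
  ext g
  rw [← inv_mem_iff (H := hb.rightStab), mem_leftStab, mem_rightStab, ← conv_injective.eq_iff,
    conv_comp, conv_conv, coe_inv_squareFunctions]

theorem comp_conv_eq_iff (hb : IsRectAtom x y b) {f : squareFunctions (x : A)}
    {g : squareFunctions (y : A)} :
    (g : A) ⨾ conv b = conv b ⨾ (f : A) ↔ (f : A) ⨾ b = b ⨾ (g : A) := by
  rw [← conv_injective.eq_iff, conv_comp, conv_comp, conv_conv, ← coe_inv_squareFunctions,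
    ← coe_inv_squareFunctions]
  constructor
  · intro h
    have h1 := congrArg (fun r => (f : A) ⨾ r ⨾ (g : A)) h
    have h2 := comp_comp_inv (hb.function_comp f).le_rect g⁻¹
    have h3 := inv_comp_comp hb.le_rect f⁻¹
    rw [inv_inv] at h2 h3
    simp only [h3] at h1
    rw [comp_assoc, h2] at h1
    exact h1
  · intro h
    have h1 := congrArg (fun r => ((f⁻¹ : squareFunctions (x : A)) : A) ⨾ r ⨾
      ((g⁻¹ : squareFunctions (y : A)) : A)) h
    simp only [inv_comp_comp hb.le_rect] at h1
    rw [← comp_assoc, comp_comp_inv hb.le_rect] at h1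
    exact h1

/-- By normality `f` fixes `k ⨾ d`, so this atom lies below both `b ⨾ c` and `b ⨾ (g ⨾ c)`. Hence `g
⨾ c ≤ conv b ⨾ b ⨾ c`, and `g` acts on `c` as some element of the right stabilizer of `b` does. -/
theorem mem_sup_of_comp_eq (hb : IsRectAtom x y b) (hc : IsRectAtom y z c)
    (hd : IsRectAtom x z d) {f : squareFunctions (x : A)} {g : squareFunctions (y : A)}
    (hf : f ∈ hd.leftStab) (hfg : (f : A) ⨾ b = b ⨾ (g : A)) :
    g ∈ hb.rightStab ⊔ hc.leftStab := by
  obtain ⟨k, hk⟩ := hb.exists_function_comp_le_comp hc hd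
  have h1 : (k : A) ⨾ d = (f : A) ⨾ ((k : A) ⨾ d) := by
    have h := hd.leftStab_normal.conj_mem f hf k⁻¹
    rwa [inv_inv, mul_assoc, inv_mul_mem_leftStab, mul_comp_eq] at h
  have h2 : (k : A) ⨾ d ≤ b ⨾ ((g : A) ⨾ c) := by
    rw [comp_assoc, ← hfg, h1, ← comp_assoc]
    exact comp_mono_right _ hk
  have h3 : (g : A) ⨾ c ≤ conv b ⨾ conv (conv b) ⨾ c := by
    rw [conv_conv, ← comp_assoc]
    exact ((hc.function_comp g).le_conv_comp_of_le_comp (hd.function_comp k).isAtom.1 h2).trans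
      (comp_mono_right _ hk)
  obtain ⟨h, hh, he⟩ := hb.converse.exists_leftStab_comp_eq (hc.function_comp g) hc h3
  rw [leftStab_converse] at hh
  have h4 := mul_mem (Subgroup.mem_sup_left hh)
    (Subgroup.mem_sup_right (S := hb.rightStab) (hc.inv_mul_mem_leftStab.mpr he))
  rwa [mul_inv_cancel_left] at h4

/-- The product of stabilizers is mapped to the product of stabilizers. -/
theorem quotientImage_stabEquiv (hb : IsRectAtom x y b) (hc : IsRectAtom y z c)
    (hd : IsRectAtom x z d) :
    quotientImage hb.stabEquiv (hb.leftStab ⊔ hd.leftStab) = hb.rightStab ⊔ hc.leftStab := by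
  obtain ⟨k, hk⟩ := hb.exists_function_comp_le_comp hc hd
  refine le_antisymm (fun g hg => ?_) (sup_le (fun g hg => ?_) fun g hg => ?_)
  · obtain ⟨f, hf, hfg⟩ := (mem_quotientImage _ _ g).mp hg
    obtain ⟨f₁, hf₁, f₂, hf₂, he⟩ := Subgroup.mem_sup_of_normal_right.mp hf
    -- The factor `f₁` fixes `b`, so `f₂ ⨾ b = f ⨾ b` and `f₂` may replace `f`.
    have hfg' := (hb.stabEquiv_mk f g).mp hfg
    refine hb.mem_sup_of_comp_eq hc hd hf₂ (Eq.trans ?_ hfg')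
    rw [← inv_mul_mem_leftStab, ← he]
    have h := hb.leftStab_normal.conj_mem f₁ hf₁ f₂⁻¹
    rwa [inv_inv, mul_assoc] at h
  · refine (mem_quotientImage _ _ g).mpr ⟨1, one_mem _, (hb.stabEquiv_mk 1 g).mpr ?_⟩
    rw [one_comp_eq hb.le_rect, hb.mem_rightStab.mp hg]
  · obtain ⟨f, hf⟩ := hb.exists_comp_eq_left g
    refine (mem_quotientImage _ _ g).mpr ⟨f, ?_, (hb.stabEquiv_mk f g).mpr hf⟩
    -- As `g` fixes `c`, both `k` and `f * k` translate `d` below `b ⨾ c`; hence `k⁻¹ * f * k`, and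
    -- with it `f`, lies in the product.
    have h1 : ((f * k : squareFunctions (x : A)) : A) ⨾ d ≤ b ⨾ c := by
      rw [mul_comp_eq, ← hc.mem_leftStab.mp hg, comp_assoc b, ← hf, ← comp_assoc]
      exact comp_mono_right _ hk
    have h2 := Subgroup.Normal.conj_mem inferInstance _ (hb.inv_mul_mem_sup hc hd hk h1) k
    rwa [← mul_assoc, mul_inv_cancel, one_mul, mul_inv_cancel_right] at h2

/-- Transfer along `b` followed by transfer along `c` is transfer along `d`, up to the inner
automorphism determined by `k`. -/
theorem mem_quotientImage_of_comp_eq (hb : IsRectAtom x y b) (hc : IsRectAtom y z c)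
    (hd : IsRectAtom x z d) {k f : squareFunctions (x : A)} {g : squareFunctions (y : A)}
    {p q : squareFunctions (z : A)} (hk : (k : A) ⨾ d ≤ b ⨾ c) (hfg : (f : A) ⨾ b = b ⨾ (g : A))
    (hgp : (g : A) ⨾ c = c ⨾ (p : A))
    (hq : ((k⁻¹ * f * k : squareFunctions (x : A)) : A) ⨾ d = d ⨾ (q : A)) :
    q * p⁻¹ ∈ quotientImage hd.stabEquiv (hb.leftStab ⊔ hd.leftStab) := by
  obtain ⟨s, hs⟩ := hd.exists_comp_eq_left (q * p⁻¹)
  refine (mem_quotientImage _ _ _).mpr ⟨s, ?_, (hd.stabEquiv_mk s _).mpr hs⟩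
  -- Moving `q` and `p⁻¹` through the triangle shows that `k * s` represents the same coset as `k`.
  have h1 : ((k * s : squareFunctions (x : A)) : A) ⨾ d ≤ b ⨾ c := by
    have h2 : (k : A) ⨾ (d ⨾ (q : A)) = (f : A) ⨾ ((k : A) ⨾ d) := by
      rw [← hq, ← mul_comp_eq, ← mul_comp_eq, mul_assoc k⁻¹, mul_inv_cancel_left]
    rw [mul_comp_eq, hs, comp_mul_eq, comp_assoc, h2]
    calc _ ≤ (f : A) ⨾ (b ⨾ c) ⨾ ((p⁻¹ : squareFunctions (z : A)) : A) :=
          comp_mono_left (comp_mono_right _ hk) _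
      _ = b ⨾ c := by
          rw [comp_assoc, hfg, ← comp_assoc b, hgp, ← comp_assoc b, comp_comp_inv hc.le_rect]
  have h2 := hb.inv_mul_mem_sup hc hd hk h1
  rwa [inv_mul_cancel_left] at h2

/-- Both sides are the product of the right stabilizers of `c` and `d`, by the previous image
formula for the triangles `(y, z, x)` and `(x, z, y)`. This gives the two induced maps into the
group of `z` a common target. -/
theorem quotientImage_stabEquiv_eq (hb : IsRectAtom x y b) (hc : IsRectAtom y z c)
    (hd : IsRectAtom x z d) :
    quotientImage hc.stabEquiv (hb.rightStab ⊔ hc.leftStab) =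
      quotientImage hd.stabEquiv (hb.leftStab ⊔ hd.leftStab) := by
  have h1 := hc.quotientImage_stabEquiv hd.converse hb.converse
  have h2 := hd.quotientImage_stabEquiv hc.converse hb
  rw [leftStab_converse hb, leftStab_converse hd, sup_comm] at h1
  rw [leftStab_converse hc, sup_comm, sup_comm hd.rightStab] at h2
  exact h1.trans h2.symm

theorem exists_induced_trans_eq (hb : IsRectAtom x y b) (hc : IsRectAtom y z c)
    (hd : IsRectAtom x z d) {k : squareFunctions (x : A)} (hk : (k : A) ⨾ d ≤ b ⨾ c) :
    ∃ (φxy : squareFunctions (x : A) ⧸ (hb.leftStab ⊔ hd.leftStab) ≃*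
          squareFunctions (y : A) ⧸ (hb.rightStab ⊔ hc.leftStab))
      (φyz : squareFunctions (y : A) ⧸ (hb.rightStab ⊔ hc.leftStab) ≃*
          squareFunctions (z : A) ⧸ quotientImage hd.stabEquiv (hb.leftStab ⊔ hd.leftStab))
      (φxz : squareFunctions (x : A) ⧸ (hb.leftStab ⊔ hd.leftStab) ≃*
          squareFunctions (z : A) ⧸ quotientImage hd.stabEquiv (hb.leftStab ⊔ hd.leftStab)),
      IsInducedBy hb.stabEquiv φxy ∧ IsInducedBy hc.stabEquiv φyz ∧
      IsInducedBy hd.stabEquiv φxz ∧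
      φxy.trans φyz = (MulAut.conj (QuotientGroup.mk k :
        squareFunctions (x : A) ⧸ (hb.leftStab ⊔ hd.leftStab))⁻¹ : MulAut _).trans φxz := by
  obtain ⟨φxy, hxy⟩ := exists_isInducedBy hb.stabEquiv (le_sup_left (b := hd.leftStab))
    (hb.quotientImage_stabEquiv hc hd)
  obtain ⟨φyz, hyz⟩ := exists_isInducedBy hc.stabEquiv (le_sup_right (a := hb.rightStab))
    (hb.quotientImage_stabEquiv_eq hc hd)
  obtain ⟨φxz, hxz⟩ := exists_isInducedBy hd.stabEquiv (le_sup_right (a := hb.leftStab)) rfl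
  refine ⟨φxy, φyz, φxz, hxy, hyz, hxz, MulEquiv.ext fun D => ?_⟩
  obtain ⟨f, rfl⟩ := QuotientGroup.mk_surjective D
  obtain ⟨g, hg⟩ := hb.exists_comp_eq_right f
  obtain ⟨p, hp⟩ := hc.exists_comp_eq_right g
  obtain ⟨q, hq⟩ := hd.exists_comp_eq_right (k⁻¹ * f * k)
  have hconj : MulAut.conj (QuotientGroup.mk k :
      squareFunctions (x : A) ⧸ (hb.leftStab ⊔ hd.leftStab))⁻¹ (QuotientGroup.mk f) =
      QuotientGroup.mk (k⁻¹ * f * k) := by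
    rw [MulAut.conj_apply, inv_inv]
    rfl
  rw [MulEquiv.trans_apply, MulEquiv.trans_apply, hconj,
    hxy.2.2 f g ((hb.stabEquiv_mk f g).mpr hg), hyz.2.2 g p ((hc.stabEquiv_mk g p).mpr hp),
    hxz.2.2 _ q ((hd.stabEquiv_mk _ q).mpr hq), QuotientGroup.eq]
  exact (Subgroup.Normal.mem_comm_iff inferInstance).mp
    (hb.mem_quotientImage_of_comp_eq hc hd hk hg hp hq)

end IsRectAtom

end RelationAlgebra

/-! ### The triple of a semi-scaffold: existence, semi-frame conditions, uniqueness. -/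

namespace GroupTriple

open RelationAlgebra

variable {A : Type u} [BooleanAlgebra A] [RelationAlgebra A]

theorem isRectAtom_elem (a : SemiScaffold A) {x y : MeasurableAtoms A}
    (h : (rectSetoid A).r x y) : IsRectAtom x y (a.elem h) :=
  ⟨a.isAtom h, a.le_rect h⟩

/-- The group triple determined by a semi-scaffold. -/
noncomputable def ofSemiScaffold (a : SemiScaffold A) : GroupTriple A (rectSetoid A) where
  carrier x := squareFunctions (x : A)
  group x := squareGroup x
  disjoint _ _ h := disjoint_squareFunctions h
  H h := (isRectAtom_elem a h).leftStab
  K h := (isRectAtom_elem a h).rightStab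
  H_normal h := (isRectAtom_elem a h).leftStab_normal
  K_normal h := (isRectAtom_elem a h).rightStab_normal
  φ h := (isRectAtom_elem a h).stabEquiv
  C hxy hyz := QuotientGroup.mk ((isRectAtom_elem a hxy).exists_function_comp_le_comp
    (isRectAtom_elem a hyz) (isRectAtom_elem a ((rectSetoid A).trans hxy hyz))).choose

theorem isDeterminedBy_ofSemiScaffold (a : SemiScaffold A) :
    (ofSemiScaffold a).IsDeterminedBy a where
  carrier_eq _ := rfl
  mul_eq _ _ _ := rfl
  one_eq _ := rfl
  inv_eq _ _ := rfl
  mem_H _ _ := Iff.rfl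
  mem_K _ _ := Iff.rfl
  φ_eq h f g := (isRectAtom_elem a h).stabEquiv_mk f g
  C_eq hxy hyz := ⟨_, ((isRectAtom_elem a hxy).exists_function_comp_le_comp
    (isRectAtom_elem a hyz) (isRectAtom_elem a ((rectSetoid A).trans hxy hyz))).choose_spec, rfl⟩

theorem isSemiFrame_ofSemiScaffold (a : SemiScaffold A) : (ofSemiScaffold a).IsSemiFrame where
  cond_i x := by
    have hx := isRectAtom_elem a ((rectSetoid A).refl x)
    have he := a.elem_refl x
    refine ⟨?_, ?_, fun f => (hx.stabEquiv_mk f f).mpr ?_⟩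
    · refine (Subgroup.eq_bot_iff_forall _).mpr fun f hf => Subtype.ext ?_
      have h := hx.mem_leftStab.mp hf
      rw [he] at h
      exact (comp_eq_of_le_rect' x.2.le_ident x.2.le_ident f.2.2.2).symm.trans h
    · refine (Subgroup.eq_bot_iff_forall _).mpr fun f hf => Subtype.ext ?_
      have h := hx.mem_rightStab.mp hf
      rw [he] at h
      exact (comp_eq_of_le_rect x.2.le_ident f.2.2.2).symm.trans h
    · rw [he]
      exact (comp_eq_of_le_rect' x.2.le_ident x.2.le_ident f.2.2.2).trans
        (comp_eq_of_le_rect x.2.le_ident f.2.2.2).symm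
  cond_ii {x y} h := by
    have hb := isRectAtom_elem a h
    have hs := isRectAtom_elem a ((rectSetoid A).symm h)
    have he := a.elem_symm h
    have hl : hs.leftStab = hb.rightStab := by
      rw [← hb.leftStab_converse]
      ext g
      rw [hs.mem_leftStab, he, hb.converse.mem_leftStab]
    have hr : hs.rightStab = hb.leftStab := by
      rw [← hs.leftStab_converse]
      ext f
      rw [hs.converse.mem_leftStab, he, conv_conv, hb.mem_leftStab]
    refine ⟨hl, hr, fun f g => (hb.stabEquiv_mk f g).trans ?_⟩
    refine Iff.trans ?_ (hs.stabEquiv_mk g f).symm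
    rw [he]
    exact hb.comp_conv_eq_iff.symm
  cond_iii hxy hyz := (isRectAtom_elem a hxy).quotientImage_stabEquiv (isRectAtom_elem a hyz)
    (isRectAtom_elem a ((rectSetoid A).trans hxy hyz))
  cond_iv hxy hyz := (isRectAtom_elem a hxy).exists_induced_trans_eq (isRectAtom_elem a hyz)
    (isRectAtom_elem a ((rectSetoid A).trans hxy hyz))
    ((isRectAtom_elem a hxy).exists_function_comp_le_comp (isRectAtom_elem a hyz)
      (isRectAtom_elem a ((rectSetoid A).trans hxy hyz))).choose_spec

theorem IsDeterminedBy.eq_ofSemiScaffold {a : SemiScaffold A} {F : GroupTriple A (rectSetoid A)}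
    (hF : F.IsDeterminedBy a) : F = ofSemiScaffold a := by
  obtain ⟨carrier, group, disj, H, K, H_normal, K_normal, φ, C⟩ := F
  obtain ⟨carrier_eq, mul_eq, one_eq, inv_eq, mem_H, mem_K, φ_eq, C_eq⟩ := hF
  -- The fields are replaced in order of dependency, so that each equation is well typed once the
  -- earlier ones are substituted.
  obtain rfl : carrier = fun x : MeasurableAtoms A => squareFunctions (x : A) := funext carrier_eq
  obtain rfl : group = fun x => squareGroup x := funext fun x =>
    Group.ext (funext fun f => funext fun g => Subtype.ext (mul_eq x f g))
  obtain rfl : @H = fun {x y} h => (isRectAtom_elem a h).leftStab := by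
    funext x y h
    exact Subgroup.ext fun f => mem_H h f
  obtain rfl : @K = fun {x y} h => (isRectAtom_elem a h).rightStab := by
    funext x y h
    exact Subgroup.ext fun f => mem_K h f
  obtain rfl : @φ = fun {x y} h => (isRectAtom_elem a h).stabEquiv := by
    funext x y h
    refine MulEquiv.ext fun D => ?_
    obtain ⟨f, rfl⟩ := QuotientGroup.mk_surjective D
    obtain ⟨g, hg⟩ := (isRectAtom_elem a h).exists_comp_eq_right f
    exact ((φ_eq h f g).mpr hg).trans (((isRectAtom_elem a h).stabEquiv_mk f g).mpr hg).symm
  obtain rfl : @C = fun {x y z} hxy hyz => (ofSemiScaffold a).C hxy hyz := by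
    funext x y z hxy hyz
    obtain ⟨f, hf, hC⟩ := C_eq hxy hyz
    obtain ⟨f', hf', hC'⟩ := (isDeterminedBy_ofSemiScaffold a).C_eq hxy hyz
    refine hC.trans (Eq.trans ?_ hC'.symm)
    -- The two chosen representatives of `C` may differ, but only by an element of the product of
    -- stabilizers.
    exact QuotientGroup.eq.mpr ((isRectAtom_elem a hxy).inv_mul_mem_sup (isRectAtom_elem a hyz)
      (isRectAtom_elem a ((rectSetoid A).trans hxy hyz)) hf hf')
  rfl

end GroupTriple

theorem mainTheorem6 {A : Type u} [CompleteBooleanAlgebra A] [IsAtomic A] [RelationAlgebra A]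
    (hA : RelationAlgebra.IsMeasurable A) (a : RelationAlgebra.SemiScaffold A) :
    ∃ F : GroupTriple A (RelationAlgebra.rectSetoid A),
      F.IsDeterminedBy a ∧
      (∀ F' : GroupTriple A (RelationAlgebra.rectSetoid A), F'.IsDeterminedBy a → F' = F) ∧
      F.IsSemiFrame :=
  ⟨GroupTriple.ofSemiScaffold a, GroupTriple.isDeterminedBy_ofSemiScaffold a,
    fun _ h => h.eq_ofSemiScaffold, GroupTriple.isSemiFrame_ofSemiScaffold a⟩
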